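/- Let $G$ be a group and let $M$ be a $G$-module. For $n\ge 0$ let $\Lambda^{n}\mathbb Z[G]$ be the $n$-th exterior power over $\mathbb Z$ of the group ring, with $G$ acting by $g(g_1\wedge\dots\wedge g_n)=gg_1\wedge\dots\wedge gg_n$, and with the $G$-equivariant differential $$\partial:\Lambda^{n+1}\mathbb Z[G]\to\Lambda^{n}\mathbb Z[G],\qquad \partial(g_0\wedge\dots\wedge g_n)=\sum_{i=0}^n(-1)^i\,g_0\wedge\dots\wedge\widehat{g_i}\wedge\dots\wedge g_n .$$ The exterior cohomology $H^n_\lambda(G,M)$ is the $n$-th cohomology group of the cochain complex $$\mathrm{Hom}_G(\Lambda^1\mathbb Z[G],M)\to \mathrm{Hom}_G(\Lambda^2\mathbb Z[G],M)\to\cdots\to\mathrm{Hom}_G(\Lambda^{n+1}\mathbb Z[G],M)\to\cdots$$ with $\mathrm{Hom}_G(\Lambda^{n+1}\mathbb Z[G],M)$ in degree $n$ and coboundary $f\mapsto f\circ\partial$. Sending $f\in\mathrm{Hom}_G(\Lambda^{n+1}\mathbb Z[G],M)$ to the inhomogeneous cochain $(g_1,\dots,g_n)\mapsto f(1\wedge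 g_1\wedge g_1g_2\wedge\dots\wedge g_1g_2\cdots g_n)$, that is, including exterior cochains into the homogeneous cochains of $G$, is a map of cochain complexes and induces natural homomorphisms $\beta^n:H^n_\lambda(G,M)\to H^n(G,M)$ to ordinary group cohomology. Let $\ell$ be a prime number, let $G=C_\ell$ be a cyclic group of order $\ell$, and let $M$ be any $G$-module. Then $\beta^i:H^i_\lambda(C_\ell,M)\to H^i(C_\ell,M)$ is an isomorphism for all $0\le i\le \ell-1$, and $H^i_\lambda(C_\ell,M)=0$ for all $i\ge \ell$. -/

import Mathlib

open CategoryTheory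
open scoped MonoidAlgebra

noncomputable section

universe u

namespace ExteriorCohomology

section Resolution

variable (k G : Type u) [CommRing k] [Group G]

/-- The augmentation `ε : k[G] → k`, the linear map with `ε g = 1` for all `g ∈ G`. -/
def augmentation : k[G] →ₗ[k] k :=
  (MonoidAlgebra.lift k k G (1 : G →* k)).toLinearMap

/-- The element `g₁ ∧ ⋯ ∧ gₙ` of `Λⁿ k[G]`, for a tuple of elements of `G`. -/
def wedge {n : ℕ} (g : Fin n → G) : ⋀[k]^n k[G] :=
  exteriorPower.ιMulti k n fun i => MonoidAlgebra.of k G (g i)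

/-- The action of `G` on `Λⁿ k[G]`: `g (g₁ ∧ ⋯ ∧ gₙ) = g g₁ ∧ ⋯ ∧ g gₙ`. -/
def rep (n : ℕ) : Representation k G (⋀[k]^n k[G]) where
  toFun g := exteriorPower.map n (Representation.leftRegular k G g)
  map_one' := by
    rw [map_one]
    exact exteriorPower.map_id (R := k) (M := k[G])
  map_mul' g h := by
    rw [map_mul]
    exact exteriorPower.map_comp (Representation.leftRegular k G h)
      (Representation.leftRegular k G g)

/-- The bilinear map `(a, a₁ ∧ ⋯ ∧ aₙ) ↦ ε(a) a₁ ∧ ⋯ ∧ aₙ`, alternating in the `aᵢ`. -/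
def augmentationSMul (n : ℕ) : k[G] →ₗ[k] k[G] [⋀^Fin n]→ₗ[k] (⋀[k]^n k[G]) :=
  (augmentation k G).smulRight (exteriorPower.ιMulti k n)

/-- The differential `∂ : Λⁿ⁺¹ k[G] → Λⁿ k[G]`; see `boundary_wedge` for its values on
`g₀ ∧ ⋯ ∧ gₙ`. -/
def boundary (n : ℕ) : (⋀[k]^(n + 1) k[G]) →ₗ[k] (⋀[k]^n k[G]) :=
  exteriorPower.alternatingMapLinearEquiv
    (AlternatingMap.alternatizeUncurryFin (augmentationSMul k G n))

variable {k G}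

@[simp]
theorem augmentation_of (g : G) : augmentation k G (MonoidAlgebra.of k G g) = 1 := by
  simp [augmentation]

theorem augmentation_leftRegular (g : G) (x : k[G]) :
    augmentation k G (Representation.leftRegular k G g x) = augmentation k G x := by
  induction x using MonoidAlgebra.induction_on with
  | of h => simp [augmentation]
  | add x y hx hy => simp [hx, hy]
  | smul r x hx => rw [map_smul, map_smul, map_smul, hx]

theorem rep_wedge {n : ℕ} (h : G) (g : Fin n → G) :
    rep k G n h (wedge k G g) = wedge k G fun i => h * g i := by
  simp [rep, wedge, Function.comp_def]

theorem boundary_ιMulti (n : ℕ) (a : Fin (n + 1) → k[G]) :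
    boundary k G n (exteriorPower.ιMulti k (n + 1) a) =
      ∑ i : Fin (n + 1), (-1 : ℤ) ^ (i : ℕ) •
        (augmentation k G (a i) • exteriorPower.ιMulti k n (i.removeNth a)) := by
  simp only [boundary, exteriorPower.alternatingMapLinearEquiv_apply_ιMulti]
  simp [augmentationSMul, AlternatingMap.alternatizeUncurryFin_apply]

/-- `∂(g₀ ∧ ⋯ ∧ gₙ) = ∑ (-1)ⁱ g₀ ∧ ⋯ ∧ ĝᵢ ∧ ⋯ ∧ gₙ`. -/
theorem boundary_wedge (n : ℕ) (g : Fin (n + 1) → G) :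
    boundary k G n (wedge k G g) =
      ∑ i : Fin (n + 1), (-1 : ℤ) ^ (i : ℕ) • wedge k G (i.removeNth g) := by
  rw [wedge, boundary_ιMulti]
  simp only [augmentation_of, one_smul]
  rfl

theorem boundary_rep (n : ℕ) (g : G) (x : ⋀[k]^(n + 1) k[G]) :
    boundary k G n (rep k G (n + 1) g x) = rep k G n g (boundary k G n x) := by
  suffices h : boundary k G n ∘ₗ rep k G (n + 1) g = rep k G n g ∘ₗ boundary k G n from
    LinearMap.congr_fun h x
  apply exteriorPower.linearMap_ext
  ext1 a
  simp only [LinearMap.compAlternatingMap_apply, LinearMap.comp_apply, boundary_ιMulti, map_sum,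
    rep, MonoidHom.coe_mk, OneHom.coe_mk, exteriorPower.map_apply_ιMulti,
    Function.comp_apply, augmentation_leftRegular]
  refine Finset.sum_congr rfl fun i _ => ?_
  rw [map_zsmul, LinearMap.map_smul, exteriorPower.map_apply_ιMulti]
  rfl

theorem boundary_boundary (n : ℕ) (x : ⋀[k]^(n + 2) k[G]) :
    boundary k G n (boundary k G (n + 1) x) = 0 := by
  suffices h : boundary k G n ∘ₗ boundary k G (n + 1) = 0 from LinearMap.congr_fun h x
  apply exteriorPower.linearMap_ext
  ext1 a
  have key := congrArg (fun f => f a)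
    (AlternatingMap.alternatizeUncurryFin_alternatizeUncurryFinLM_comp_of_symmetric
      (f := (augmentation k G).smulRight (augmentationSMul k G n))
      (fun a b => by
        simp only [LinearMap.smulRight_apply, augmentationSMul, LinearMap.smul_apply]
        rw [smul_comm]))
  rw [LinearMap.compAlternatingMap_apply, LinearMap.comp_apply, boundary_ιMulti, map_sum]
  refine Eq.trans (Finset.sum_congr rfl fun i _ => ?_)
    ((AlternatingMap.alternatizeUncurryFin_apply _ a).symm.trans key)
  rw [map_zsmul, LinearMap.map_smul, boundary,
    exteriorPower.alternatingMapLinearEquiv_apply_ιMulti, LinearMap.comp_apply,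
    LinearMap.smulRight_apply, map_smul]
  rfl

end Resolution

variable {k G : Type u} [CommRing k] [Group G] (M : Rep.{u} k G)

/-- The group `Hom_G(Λⁿ⁺¹ k[G], M)` of exterior `n`-cochains. -/
abbrev Cochain (n : ℕ) : Type u := (rep k G (n + 1)).IntertwiningMap M.ρ

/-- The coboundary map `f ↦ f ∘ ∂`. -/
def coboundary (n : ℕ) : Cochain M n →ₗ[k] Cochain M (n + 1) where
  toFun f := (f.toLinearMap ∘ₗ boundary k G (n + 1)).intertwiningMap_of_isIntertwiningMap _ _
    fun g x => by
      rw [LinearMap.comp_apply, boundary_rep]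
      exact Representation.IntertwiningMap.isIntertwining _ _ f g _
  map_add' _ _ := rfl
  map_smul' _ _ := rfl

/-- The cochain complex `Hom_G(Λ¹ k[G], M) → Hom_G(Λ² k[G], M) → ⋯`, with
`Hom_G(Λⁿ⁺¹ k[G], M)` in degree `n`. -/
def cochainComplex : CochainComplex (ModuleCat k) ℕ :=
  CochainComplex.of (fun n => ModuleCat.of k (Cochain M n))
    (fun n => ModuleCat.ofHom (coboundary M n)) fun n => by
      refine ModuleCat.hom_ext (LinearMap.ext fun f => ?_)
      refine Representation.IntertwiningMap.ext (LinearMap.ext fun x => ?_)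
      exact (congrArg f (boundary_boundary (n + 1) x)).trans (map_zero f)

theorem cochainComplex_d (n : ℕ) :
    (cochainComplex M).d n (n + 1) = ModuleCat.ofHom (coboundary M n) :=
  CochainComplex.of_d (fun n => ModuleCat.of k (Cochain M n))
    (fun n => ModuleCat.ofHom (coboundary M n)) n

/-- The exterior cohomology group `Hⁿ_λ(G, M)`. -/
def exteriorCohomology (n : ℕ) : ModuleCat k := (cochainComplex M).homology n

/-- The inclusion of exterior cochains into inhomogeneous cochains: the composite of the inclusion
`f ↦ ((g₀, …, gₙ) ↦ f (g₀ ∧ ⋯ ∧ gₙ))` into the homogeneous cochains with the standard isomorphism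
`F ↦ ((g₁, …, gₙ) ↦ F (1, g₁, g₁g₂, …, g₁⋯gₙ))`. -/
def toInhomogeneous (n : ℕ) : Cochain M n →ₗ[k] ((Fin n → G) → M) where
  toFun f g := f (wedge k G (Fin.partialProd g))
  map_add' _ _ := rfl
  map_smul' _ _ := rfl

theorem toInhomogeneous_coboundary (n : ℕ) (f : Cochain M n) :
    toInhomogeneous M (n + 1) (coboundary M n f) =
      (inhomogeneousCochains.d M n).hom (toInhomogeneous M n f) := by
  ext g
  have hd : toInhomogeneous M (n + 1) (coboundary M n f) g =
      f (boundary k G (n + 1) (wedge k G (Fin.partialProd g))) := rfl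
  have hwedge : wedge k G ((0 : Fin (n + 2)).removeNth (Fin.partialProd g)) =
      rep k G (n + 1) (g 0) (wedge k G (Fin.partialProd fun i => g i.succ)) := by
    rw [rep_wedge]
    congr 1
    ext i
    exact Fin.partialProd_succ' g i
  rw [hd, boundary_wedge, map_sum, Fin.sum_univ_succ, inhomogeneousCochains.d_hom_apply, hwedge]
  congr 1
  · simp [toInhomogeneous, f.isIntertwining]
  · refine Finset.sum_congr rfl fun j _ => ?_
    simp only [toInhomogeneous, LinearMap.coe_mk, AddHom.coe_mk, Fin.partialProd_contractNth]
    rw [map_zsmul, Fin.val_succ]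
    rcases Nat.even_or_odd ((j : ℕ) + 1) with h | h
    · simp only [h.neg_one_pow, one_smul]
      rfl
    · simp only [h.neg_one_pow, neg_smul, one_smul]
      rfl

/-- `toInhomogeneous` as a map of cochain complexes. -/
def toInhomogeneousCochains : cochainComplex M ⟶ groupCohomology.inhomogeneousCochains M :=
  CochainComplex.ofHom (fun n => ModuleCat.ofHom (toInhomogeneous M n)) fun n => by
    rw [groupCohomology.inhomogeneousCochains.d_def, cochainComplex_d]
    ext f : 2
    exact (toInhomogeneous_coboundary M n f).symm

/-- The natural map `βⁿ : Hⁿ_λ(G, M) → Hⁿ(G, M)` induced by the inclusion of cochains. -/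
def comparison (n : ℕ) : exteriorCohomology M n ⟶ groupCohomology M n :=
  HomologicalComplex.homologyMap (toInhomogeneousCochains M) n

end ExteriorCohomology

end

/-!
The exterior cochains of degree `n` are the `G`-maps from `Λⁿ⁺¹ k[G]`, and the inhomogeneous
cochains are the `G`-maps from the free module `Chain k G (n + 1)` on `(n + 1)`-tuples. The
comparison map is restriction along the surjection `toExterior`, which sends a tuple to its wedge
product, so it is enough to control the kernel `K` of `toExterior`: the quotient of the
inhomogeneous cochains by the exterior ones consists of the restrictions to `K`, and the comparison
is an isomorphism in the degrees where this quotient has no cohomology.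

Forming the cone over a tuple with a vertex `c ∈ G` contracts the chains and preserves `K`, because
`c ∧ -` is well defined on exterior powers. It is not equivariant for a fixed `c`, but coning a
tuple from its own first entry is. This fails to be a contraction only because the first entry
changes along the faces, and that is corrected inductively (`exists_equivariant_contraction`),
provided that `K` is an equivariant direct summand of the chains in the degrees met so far, i.e.
that `toExterior` has an equivariant section.

When `|G| = ℓ` is prime and `0 < n < ℓ`, such a section exists on `Λⁿ k[G]`. Indeed `G` is abelian
and `n` is invertible modulo `ℓ`, so the `n`-th root of `g₁ ⋯ gₙ` is a point of `G` depending
equivariantly and symmetrically on `g₁, …, gₙ`; translating it to `1` and sorting by a fixed total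
order of `G` chooses an ordering of each `n`-subset in an equivariant way
(`hasEquivariantSection_of_basepoint`, `hasEquivariantSection_of_coprime`). To treat cohomology in
degree `i` the sections for `0 < n ≤ i` suffice (`isIso_comparison`), which gives the range
`i ≤ ℓ - 1`. In degrees `i ≥ ℓ` there are no exterior cochains, since `i + 1` elements of `G`
cannot be distinct (`subsingleton_cochain`).
-/

noncomputable section

namespace ExteriorCohomology

/-! ### Linear maps on exterior powers of a group ring -/

section ExteriorPower

variable {k G : Type u} [CommRing k] [Group G]

/-- An alternating function of `n` elements of `G` extends to a linear map on `Λⁿ k[G]`. -/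
theorem exists_linearMap_wedge [Finite G] {N : Type*} [AddCommGroup N] [Module k N] {n : ℕ}
    (φ : (Fin n → G) → N) (h₀ : ∀ g, ¬Function.Injective g → φ g = 0)
    (h₁ : ∀ g i j, i ≠ j → φ (g ∘ Equiv.swap i j) = -φ g) :
    ∃ F : (⋀[k]^n k[G]) →ₗ[k] N, ∀ g, F (wedge k G g) = φ g := by
  classical
  have := Fintype.ofFinite G
  let μ : MultilinearMap k (fun _ : Fin n => k[G]) N :=
    ∑ g : Fin n → G, ((MultilinearMap.mkPiAlgebra k (Fin n) k).compLinearMap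
      fun i => (MonoidAlgebra.basis G k).coord (g i)).smulRight (φ g)
  have hμ (v : Fin n → k[G]) :
      μ v = ∑ g : Fin n → G, (∏ i, (MonoidAlgebra.basis G k).coord (g i) (v i)) • φ g := by
    simp [μ]
  let A : k[G] [⋀^Fin n]→ₗ[k] N :=
    { μ with
      map_eq_zero_of_eq' := fun v i j hv hij => by
        change μ v = 0
        rw [hμ]
        -- The tuples `g` and `g ∘ swap i j` contribute opposite terms.
        refine Finset.sum_involution (fun g _ => g ∘ Equiv.swap i j) (fun g _ => ?_)
          (fun g _ hg he => hg ?_) (fun _ _ => Finset.mem_univ _)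
          (fun g _ => by ext; simp)
        · have hprod : ∏ l, (MonoidAlgebra.basis G k).coord ((g ∘ Equiv.swap i j) l) (v l) =
              ∏ l, (MonoidAlgebra.basis G k).coord (g l) (v l) := by
            rw [← Equiv.prod_comp (Equiv.swap i j)
              fun l => (MonoidAlgebra.basis G k).coord (g l) (v l)]
            refine Finset.prod_congr rfl fun l _ => ?_
            have hvl : v (Equiv.swap i j l) = v l := by
              rcases eq_or_ne l i with rfl | hi
              · simp [hv]
              rcases eq_or_ne l j with rfl | hj
              · simp [hv]
              rw [Equiv.swap_apply_of_ne_of_ne hi hj]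
            rw [hvl, Function.comp_apply]
          rw [hprod, h₁ g i j hij, smul_neg, add_neg_cancel]
        · rw [h₀ g fun hinj => hij (hinj ?_), smul_zero]
          simpa using (congrFun he j) }
  refine ⟨exteriorPower.alternatingMapLinearEquiv A, fun g => ?_⟩
  rw [wedge, exteriorPower.alternatingMapLinearEquiv_apply_ιMulti]
  change μ _ = _
  rw [hμ, Finset.sum_eq_single g]
  · simp [← MonoidAlgebra.basis_apply]
  · intro b _ hb
    obtain ⟨i, hi⟩ := Function.ne_iff.1 hb
    rw [Finset.prod_eq_zero (Finset.mem_univ i), zero_smul]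
    simp [MonoidAlgebra.of_apply, ← MonoidAlgebra.basis_apply, hi.symm]
  · simp

theorem linearMap_ext_wedge {N : Type*} [AddCommGroup N] [Module k N] {n : ℕ}
    {F₁ F₂ : (⋀[k]^n k[G]) →ₗ[k] N} (h : ∀ g, F₁ (wedge k G g) = F₂ (wedge k G g)) : F₁ = F₂ := by
  apply exteriorPower.linearMap_ext
  refine Module.Basis.ext_alternating (MonoidAlgebra.basis G k) fun v _ => ?_
  simpa [wedge] using h v

theorem wedge_comp_perm {n : ℕ} (g : Fin n → G) (σ : Equiv.Perm (Fin n)) :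
    wedge k G (g ∘ σ) = Equiv.Perm.sign σ • wedge k G g :=
  AlternatingMap.map_perm _ (fun i => MonoidAlgebra.of k G (g i)) σ

theorem wedge_eq_zero {n : ℕ} {g : Fin n → G} (hg : ¬Function.Injective g) : wedge k G g = 0 :=
  AlternatingMap.map_eq_zero_of_not_injective _ _ fun h =>
    hg fun _ _ hij => h (congrArg (MonoidAlgebra.of k G) hij)

end ExteriorPower

/-! ### The standard resolution and its map to the exterior powers -/

section Chains

variable (k G : Type u) [CommRing k]

/-- The free `k`-module on `n`-tuples of elements of `G`, that is, the homogeneous standard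
resolution shifted by one: `Chain k G (n + 1)` is its term of degree `n`, and `Chain k G 0` is
the copy of `k` that it augments to. -/
abbrev Chain (n : ℕ) : Type u := (Fin n → G) →₀ k

/-- The differential `(g₀, …, gₙ) ↦ ∑ (-1)ⁱ (g₀, …, ĝᵢ, …, gₙ)`. -/
def chainBoundary (n : ℕ) : Chain k G (n + 1) →ₗ[k] Chain k G n :=
  Finsupp.linearCombination k fun g =>
    ∑ i : Fin (n + 1), (-1 : ℤ) ^ (i : ℕ) • Finsupp.single (i.removeNth g) 1

variable {k G}

/-- The cone `(g₁, …, gₙ) ↦ (c, g₁, …, gₙ)` with vertex `c`. -/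
def chainCons {n : ℕ} (c : G) : Chain k G n →ₗ[k] Chain k G (n + 1) :=
  Finsupp.lmapDomain k k fun g => (Fin.cons c g : Fin (n + 1) → G)

theorem chain_ext {N : Type*} [AddCommGroup N] [Module k N] {n : ℕ} {F₁ F₂ : Chain k G n →ₗ[k] N}
    (h : ∀ g, F₁ (Finsupp.single g 1) = F₂ (Finsupp.single g 1)) : F₁ = F₂ :=
  Finsupp.lhom_ext' fun g => LinearMap.ext_ring (h g)

theorem chainBoundary_single (n : ℕ) (g : Fin (n + 1) → G) :
    chainBoundary k G n (Finsupp.single g 1) =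
      ∑ i : Fin (n + 1), (-1 : ℤ) ^ (i : ℕ) • Finsupp.single (i.removeNth g) 1 := by
  simp [chainBoundary]

@[simp]
theorem chainCons_single {n : ℕ} (c : G) (g : Fin n → G) (a : k) :
    chainCons c (Finsupp.single g a) = Finsupp.single (Fin.cons c g : Fin (n + 1) → G) a := by
  simp [chainCons]

theorem chainBoundary_chainCons (n : ℕ) (c : G) (x : Chain k G (n + 1)) :
    chainBoundary k G (n + 1) (chainCons c x) = x - chainCons c (chainBoundary k G n x) := by
  suffices H : chainBoundary k G (n + 1) ∘ₗ chainCons c =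
      LinearMap.id - chainCons c ∘ₗ chainBoundary k G n from LinearMap.congr_fun H x
  refine chain_ext fun g => ?_
  simp only [LinearMap.comp_apply, LinearMap.sub_apply, LinearMap.id_apply, chainCons_single,
    chainBoundary_single, map_sum, map_zsmul]
  rw [Fin.sum_univ_succ, sub_eq_add_neg, ← Finset.sum_neg_distrib]
  congr 1
  · simp
  · refine Finset.sum_congr rfl fun i _ => ?_
    rw [Fin.val_succ, pow_succ, mul_neg_one, neg_smul]
    congr 3
    exact Fin.cons_comp_succ_succAbove c g i

variable [Group G]

/-- The diagonal action of `G` on tuples. -/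
def chainRep {n : ℕ} (h : G) : Chain k G n →ₗ[k] Chain k G n :=
  Finsupp.lmapDomain k k fun g i => h * g i

variable (k G) in
/-- The quotient map `(g₁, …, gₙ) ↦ g₁ ∧ ⋯ ∧ gₙ`. -/
def toExterior (n : ℕ) : Chain k G n →ₗ[k] (⋀[k]^n k[G]) :=
  Finsupp.linearCombination k (wedge k G)

@[simp]
theorem chainRep_single {n : ℕ} (h : G) (g : Fin n → G) (a : k) :
    chainRep h (Finsupp.single g a) = Finsupp.single (fun i => h * g i) a := by
  simp [chainRep]

@[simp]
theorem toExterior_single (n : ℕ) (g : Fin n → G) :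
    toExterior k G n (Finsupp.single g 1) = wedge k G g := by
  simp [toExterior]

theorem chainCons_chainRep {n : ℕ} (h c : G) (x : Chain k G n) :
    chainCons (h * c) (chainRep h x) = chainRep h (chainCons c x) := by
  suffices H : chainCons (h * c) ∘ₗ chainRep h = chainRep h ∘ₗ chainCons (k := k) (n := n) c from
    LinearMap.congr_fun H x
  refine chain_ext fun g => ?_
  simp only [LinearMap.comp_apply, chainRep_single, chainCons_single]
  congr 1
  ext i
  refine Fin.cases ?_ (fun _ => ?_) i <;> simp

theorem chainBoundary_chainRep (n : ℕ) (h : G) (x : Chain k G (n + 1)) :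
    chainBoundary k G n (chainRep h x) = chainRep h (chainBoundary k G n x) := by
  suffices H : chainBoundary k G n ∘ₗ chainRep h = chainRep h ∘ₗ chainBoundary k G n from
    LinearMap.congr_fun H x
  refine chain_ext fun g => ?_
  simp only [LinearMap.comp_apply, chainRep_single, chainBoundary_single, map_sum, map_zsmul]
  rfl

theorem toExterior_chainBoundary (n : ℕ) (x : Chain k G (n + 1)) :
    toExterior k G n (chainBoundary k G n x) = boundary k G n (toExterior k G (n + 1) x) := by
  suffices H : toExterior k G n ∘ₗ chainBoundary k G n =
      boundary k G n ∘ₗ toExterior k G (n + 1) from LinearMap.congr_fun H x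
  refine chain_ext fun g => ?_
  simp only [LinearMap.comp_apply, chainBoundary_single, map_sum, map_zsmul, toExterior_single,
    boundary_wedge]

theorem toExterior_chainRep (n : ℕ) (h : G) (x : Chain k G n) :
    toExterior k G n (chainRep h x) = rep k G n h (toExterior k G n x) := by
  suffices H : toExterior k G n ∘ₗ chainRep h = rep k G n h ∘ₗ toExterior k G n from
    LinearMap.congr_fun H x
  refine chain_ext fun g => ?_
  simp [rep_wedge]

theorem toExterior_surjective (n : ℕ) : Function.Surjective (toExterior k G n) := by
  rw [← LinearMap.range_eq_top, ← Submodule.ker_mkQ (LinearMap.range (toExterior k G n)),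
    LinearMap.ker_eq_top]
  refine linearMap_ext_wedge fun g => ?_
  rw [LinearMap.zero_apply, Submodule.mkQ_apply, Submodule.Quotient.mk_eq_zero]
  exact ⟨_, toExterior_single n g⟩

/-- Coning preserves the kernel of `toExterior`, since `(c, g₁, …, gₙ)` maps to
`c ∧ g₁ ∧ ⋯ ∧ gₙ`. -/
theorem toExterior_chainCons (n : ℕ) (c : G) {x : Chain k G n} (hx : toExterior k G n x = 0) :
    toExterior k G (n + 1) (chainCons c x) = 0 := by
  let A : k[G] [⋀^Fin n]→ₗ[k] (⋀[k]^(n + 1) k[G]) :=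
    (exteriorPower.ιMulti k (n + 1)).curryLeft (MonoidAlgebra.of k G c)
  suffices H : toExterior k G (n + 1) ∘ₗ chainCons c =
      exteriorPower.alternatingMapLinearEquiv A ∘ₗ toExterior k G n by
    rw [← LinearMap.comp_apply, H, LinearMap.comp_apply, hx, map_zero]
  refine chain_ext fun g => ?_
  simp only [LinearMap.comp_apply, chainCons_single, toExterior_single]
  rw [wedge, wedge, exteriorPower.alternatingMapLinearEquiv_apply_ιMulti]
  simp only [A, AlternatingMap.curryLeft_apply_apply]
  congr 1
  ext1 i
  refine Fin.cases ?_ (fun _ => ?_) i <;> simp [Matrix.vecCons]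

theorem toExterior_injective_of_subsingleton [Finite G] (n : ℕ) [Subsingleton (Fin n)] :
    Function.Injective (toExterior k G n) := by
  obtain ⟨F, hF⟩ := exists_linearMap_wedge (k := k) (fun g : Fin n → G => Finsupp.single g (1 : k))
    (fun g hg => (hg (Function.injective_of_subsingleton g)).elim)
    (fun g i j hij => (hij (Subsingleton.elim i j)).elim)
  have H : F ∘ₗ toExterior k G n = LinearMap.id := chain_ext fun g => by simp [hF]
  exact Function.LeftInverse.injective (g := F) fun x => LinearMap.congr_fun H x

end Chains

/-! ### Equivariant sections -/

section Section

variable (k G : Type u) [CommRing k] [Group G]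

/-- The quotient map from `n`-tuples to `Λⁿ k[G]` has a `G`-equivariant linear section. -/
def HasEquivariantSection (n : ℕ) : Prop :=
  ∃ s : (⋀[k]^n k[G]) →ₗ[k] Chain k G n,
    (∀ h x, s (rep k G n h x) = chainRep h (s x)) ∧ ∀ x, toExterior k G n (s x) = x

variable {G}

/-- A choice of a point of `G` for each `n`-tuple, equivariant and independent of the order of the
tuple, gives an equivariant section: translating the chosen point to `1` makes `G`-orbits of
tuples comparable with a fixed total order of `G`, and `g₁ ∧ ⋯ ∧ gₙ` is sent to the tuple sorted
in that way, with the sign of the sorting permutation. -/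
theorem hasEquivariantSection_of_basepoint [Finite G] {n : ℕ} (c : (Fin n → G) → G)
    (hc : ∀ h g, c (fun i => h * g i) = h * c g)
    (hperm : ∀ g (σ : Equiv.Perm (Fin n)), c (g ∘ σ) = c g) : HasEquivariantSection k G n := by
  classical
  let _ : LinearOrder G := linearOrderOfSTO WellOrderingRel
  let τ (g : Fin n → G) : Equiv.Perm (Fin n) := Tuple.sort fun i => (c g)⁻¹ * g i
  let φ (g : Fin n → G) : Chain k G n :=
    if Function.Injective g then Equiv.Perm.sign (τ g) • Finsupp.single (g ∘ τ g) 1 else 0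
  have hτ (g : Fin n → G) (hg : Function.Injective g) (σ : Equiv.Perm (Fin n)) :
      σ * τ (g ∘ σ) = τ g := by
    have h := Tuple.comp_perm_comp_sort_eq_comp_sort (f := fun i => (c g)⁻¹ * g i) (σ := σ)
    have h' : τ (g ∘ σ) = Tuple.sort ((fun i => (c g)⁻¹ * g i) ∘ σ) := by
      simp only [τ, hperm]
      rfl
    rw [← h'] at h
    ext1 i
    exact hg (mul_left_cancel (congrFun h i))
  have hτmul (h : G) (g : Fin n → G) : τ (fun i => h * g i) = τ g := by
    simp only [τ, hc]
    congr 1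
    ext i
    group
  obtain ⟨s, hs⟩ := exists_linearMap_wedge (k := k) φ (fun g hg => if_neg hg) fun g i j hij => by
    by_cases hg : Function.Injective g
    · have hg' : Function.Injective (g ∘ Equiv.swap i j) := hg.comp (Equiv.injective _)
      have h := hτ g hg (Equiv.swap i j)
      simp only [φ, if_pos hg, if_pos hg']
      rw [← h, Equiv.Perm.sign_mul, Equiv.Perm.sign_swap hij, Equiv.Perm.coe_mul,
        ← Function.comp_assoc]
      simp
    · have hg' : ¬Function.Injective (g ∘ Equiv.swap i j) := by
        rwa [Function.Injective.of_comp_iff' g (Equiv.bijective _)]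
      simp only [φ, if_neg hg, if_neg hg', neg_zero]
  refine ⟨s, fun h => LinearMap.congr_fun (f := s ∘ₗ rep k G n h) (g := chainRep h ∘ₗ s) ?_,
    LinearMap.congr_fun (f := toExterior k G n ∘ₗ s) (g := LinearMap.id) ?_⟩
  · refine linearMap_ext_wedge fun g => ?_
    simp only [LinearMap.comp_apply, rep_wedge, hs, φ, hτmul]
    have hinj : Function.Injective (fun i => h * g i) ↔ Function.Injective g :=
      Function.Injective.of_comp_iff (mul_right_injective h) g
    by_cases hg : Function.Injective g
    · rw [if_pos hg, if_pos (hinj.2 hg), LinearMap.map_smul_of_tower, chainRep_single]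
      rfl
    · rw [if_neg hg, if_neg (hinj.not.2 hg), map_zero]
  · refine linearMap_ext_wedge fun g => ?_
    simp only [LinearMap.comp_apply, LinearMap.id_apply, hs, φ]
    by_cases hg : Function.Injective g
    · rw [if_pos hg, LinearMap.map_smul_of_tower, toExterior_single, wedge_comp_perm, smul_smul,
        Int.units_mul_self, one_smul]
    · rw [if_neg hg, map_zero, wedge_eq_zero hg]

/-- For `n` prime to the order of a finite commutative group, the `n`-th root of the product of
the entries is an equivariant and symmetric choice of a point for each `n`-tuple. -/
theorem hasEquivariantSection_of_coprime [Finite G] [IsMulCommutative G] {n : ℕ}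
    (hn : (Nat.card G).Coprime n) : HasEquivariantSection k G n := by
  let _ : CommGroup G := { ‹Group G› with mul_comm := mul_comm' }
  refine hasEquivariantSection_of_basepoint k (fun g => (powCoprime hn).symm (∏ i, g i))
    (fun h g => ?_) fun g σ => ?_
  · have h₁ : (powCoprime hn).symm (∏ i, g i) ^ n = ∏ i, g i :=
      (powCoprime hn).apply_symm_apply _
    rw [Equiv.symm_apply_eq, powCoprime_apply, mul_pow, h₁, Finset.prod_mul_distrib]
    simp
  · rw [← Equiv.prod_comp σ g]
    rfl

end Section

/-! ### Equivariant contraction of the kernel -/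

section Homotopy

variable {k G : Type u} [CommRing k]

theorem chainBoundary_chainBoundary (n : ℕ) (x : Chain k G (n + 2)) :
    chainBoundary k G n (chainBoundary k G (n + 1) x) = 0 := by
  suffices H : chainBoundary k G n ∘ₗ chainBoundary k G (n + 1) = 0 from LinearMap.congr_fun H x
  induction n with
  | zero =>
    refine chain_ext fun g => ?_
    rw [← Fin.cons_self_tail g, ← chainCons_single, LinearMap.comp_apply, chainBoundary_chainCons]
    have H (c : G) : chainBoundary k G 0 ∘ₗ chainCons c = LinearMap.id := by
      refine chain_ext fun g => ?_
      simp [chainBoundary_single]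
    rw [map_sub, ← LinearMap.comp_apply _ (chainCons (g 0)), H, LinearMap.id_apply, sub_self,
      LinearMap.zero_apply]
  | succ n ih =>
    refine chain_ext fun g => ?_
    rw [← Fin.cons_self_tail g, ← chainCons_single, LinearMap.comp_apply, chainBoundary_chainCons,
      map_sub, chainBoundary_chainCons, ← LinearMap.comp_apply (chainBoundary k G n),
      ih (Finsupp.single (Fin.tail g) 1)]
    simp

variable [Group G]

/-- The kernel of `toExterior` is contracted by coning, but not equivariantly. As long as it is an
equivariant direct summand of the chains, coning from the first entry of each tuple yields
inductively an equivariant contraction `T`, in the sense that `∂ T ∂ = ∂` on the kernel. -/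
theorem exists_equivariant_contraction [Finite G] (n : ℕ)
    (hs : ∀ m, 0 < m → m ≤ n → HasEquivariantSection k G m) :
    ∃ T : Chain k G n →ₗ[k] Chain k G (n + 1),
      (∀ h x, T (chainRep h x) = chainRep h (T x)) ∧
      (∀ x, toExterior k G (n + 1) (T x) = 0) ∧
      ∀ x, toExterior k G (n + 1) x = 0 →
        chainBoundary k G n (T (chainBoundary k G n x)) = chainBoundary k G n x := by
  induction n with
  | zero =>
    refine ⟨0, by simp, by simp, fun x hx => ?_⟩
    have : x = 0 := toExterior_injective_of_subsingleton 1 (hx.trans (map_zero _).symm)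
    simp [this]
  | succ n ih =>
    obtain ⟨T, hT, hT₀, hT₁⟩ := ih fun m h₀ hm => hs m h₀ (hm.trans n.le_succ)
    obtain ⟨s, hs, hs₁⟩ := hs (n + 1) n.succ_pos le_rfl
    -- The equivariant retraction of the chains onto the kernel of `toExterior`.
    let r : Chain k G (n + 1) →ₗ[k] Chain k G (n + 1) := LinearMap.id - s ∘ₗ toExterior k G (n + 1)
    have hr₀ x : toExterior k G (n + 1) (r x) = 0 := by simp [r, hs₁]
    have hr₁ x (hx : toExterior k G (n + 1) x = 0) : r x = x := by simp [r, hx]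
    have hr h x : r (chainRep h x) = chainRep h (r x) := by simp [r, toExterior_chainRep, hs]
    -- The part of `id = ∂ T + T ∂` on the kernel that remains to be supplied by `∂ T`.
    let A : Chain k G (n + 1) →ₗ[k] Chain k G (n + 1) := r - T ∘ₗ chainBoundary k G n ∘ₗ r
    have hA₀ x : toExterior k G (n + 1) (A x) = 0 := by simp [A, hr₀, hT₀]
    have hA₁ x : chainBoundary k G n (A x) = 0 := by simp [A, hT₁ _ (hr₀ x)]
    have hA h x : A (chainRep h x) = chainRep h (A x) := by
      simp [A, hr, chainBoundary_chainRep, hT]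
    let T' : Chain k G (n + 1) →ₗ[k] Chain k G (n + 2) :=
      Finsupp.linearCombination k fun g => chainCons (g 0) (A (Finsupp.single g 1))
    have hT' (g) : T' (Finsupp.single g 1) = chainCons (g 0) (A (Finsupp.single g 1)) := by
      simp [T']
    have hbT' : chainBoundary k G (n + 1) ∘ₗ T' = A := chain_ext fun g => by
      rw [LinearMap.comp_apply, hT', chainBoundary_chainCons, hA₁, map_zero, sub_zero]
    refine ⟨T', fun h => LinearMap.congr_fun (f := T' ∘ₗ chainRep h) (g := chainRep h ∘ₗ T') ?_,
      LinearMap.congr_fun (f := toExterior k G (n + 2) ∘ₗ T') (g := 0) ?_, fun x hx => ?_⟩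
    · refine chain_ext fun g => ?_
      simp only [LinearMap.comp_apply, chainRep_single, hT', ← chainCons_chainRep, ← hA]
    · refine chain_ext fun g => ?_
      rw [LinearMap.comp_apply, hT', toExterior_chainCons _ _ (hA₀ _), LinearMap.zero_apply]
    · have hx' : toExterior k G (n + 1) (chainBoundary k G (n + 1) x) = 0 := by
        rw [toExterior_chainBoundary, hx, map_zero]
      rw [← LinearMap.comp_apply, hbT']
      simp [A, hr₁ _ hx', chainBoundary_chainBoundary]

/-- A homogeneous cochain whose coboundary vanishes on the kernel of `toExterior` is, on that
kernel, the coboundary of an equivariant cochain. -/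
theorem exists_eq_comp_chainBoundary_on_ker [Finite G] {N : Type*} [AddCommGroup N] [Module k N]
    (ρ : Representation k G N) (n : ℕ)
    (hs : ∀ m, 0 < m → m ≤ n → HasEquivariantSection k G m)
    (F : Chain k G (n + 1) →ₗ[k] N) (hF : ∀ h x, F (chainRep h x) = ρ h (F x))
    (hF₀ : ∀ x, toExterior k G (n + 2) x = 0 → F (chainBoundary k G (n + 1) x) = 0) :
    ∃ E : Chain k G n →ₗ[k] N, (∀ h x, E (chainRep h x) = ρ h (E x)) ∧
      ∀ x, toExterior k G (n + 1) x = 0 → F x = E (chainBoundary k G n x) := by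
  obtain ⟨T, hT, hT₀, hT₁⟩ := exists_equivariant_contraction n hs
  refine ⟨F ∘ₗ T, fun h x => by simp [hT, hF], fun x hx => ?_⟩
  rw [LinearMap.comp_apply, ← sub_eq_zero, ← map_sub]
  -- `x - T ∂ x` is a cycle in the kernel, hence the boundary of any cone over it.
  have h₀ := hF₀ (chainCons 1 (x - T (chainBoundary k G n x)))
    (toExterior_chainCons _ _ (by rw [map_sub, hx, hT₀, sub_zero]))
  rwa [chainBoundary_chainCons, map_sub (chainBoundary k G n), hT₁ x hx, sub_self, map_zero,
    sub_zero] at h₀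

end Homotopy

/-! ### Exterior cochains among the inhomogeneous cochains -/

section Cochains

variable {k G : Type u} [CommRing k] [Group G] (M : Rep.{u} k G)

/-- Inhomogeneous cochains are the values of equivariant homogeneous cochains on the tuples
`(1, g₁, g₁g₂, …)`. -/
theorem exists_equivariant_of_inhomogeneous {n : ℕ} (φ : (Fin n → G) → M) :
    ∃ F : Chain k G (n + 1) →ₗ[k] M, (∀ h x, F (chainRep h x) = M.ρ h (F x)) ∧
      ∀ g, F (Finsupp.single (Fin.partialProd g) 1) = φ g := by
  let F : Chain k G (n + 1) →ₗ[k] M := Finsupp.linearCombination k fun g =>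
    M.ρ (g 0) (φ fun i => (g i.castSucc)⁻¹ * g i.succ)
  refine ⟨F, fun h => LinearMap.congr_fun (f := F ∘ₗ chainRep h) (g := M.ρ h ∘ₗ F) ?_,
    fun g => ?_⟩
  · refine chain_ext fun g => ?_
    simp [F, mul_assoc]
  · simp [F, Fin.partialProd_right_inv]

variable {M}

/-- An equivariant map is determined by its values on tuples of the form `(1, g₁, g₁g₂, …)`, since
these represent all `G`-orbits. -/
theorem equivariant_ext {n : ℕ} {F₁ F₂ : Chain k G (n + 1) →ₗ[k] M}
    (h₁ : ∀ h x, F₁ (chainRep h x) = M.ρ h (F₁ x)) (h₂ : ∀ h x, F₂ (chainRep h x) = M.ρ h (F₂ x))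
    (h : ∀ g, F₁ (Finsupp.single (Fin.partialProd g) 1) =
      F₂ (Finsupp.single (Fin.partialProd g) 1)) : F₁ = F₂ := by
  refine chain_ext fun g => ?_
  have hg : Finsupp.single g (1 : k) = chainRep (g 0)
      (Finsupp.single (Fin.partialProd fun i => (g i.castSucc)⁻¹ * g i.succ) 1) := by
    rw [chainRep_single]
    congr 1
    exact (Fin.partialProd_left_inv g).symm
  rw [hg, h₁, h₂, h]

theorem inhomogeneous_comp_chainBoundary {n : ℕ} (F : Chain k G (n + 1) →ₗ[k] M)
    (hF : ∀ h x, F (chainRep h x) = M.ρ h (F x)) (g : Fin (n + 1) → G) :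
    F (chainBoundary k G (n + 1) (Finsupp.single (Fin.partialProd g) 1)) =
      (inhomogeneousCochains.d M n).hom
        (fun g => F (Finsupp.single (Fin.partialProd g) 1)) g := by
  have h₀ : Finsupp.single ((0 : Fin (n + 2)).removeNth (Fin.partialProd g)) (1 : k) =
      chainRep (g 0) (Finsupp.single (Fin.partialProd fun i => g i.succ) 1) := by
    rw [chainRep_single]
    congr 1
    ext i
    exact Fin.partialProd_succ' g i
  rw [chainBoundary_single, map_sum, Fin.sum_univ_succ, inhomogeneousCochains.d_hom_apply, h₀,
    map_zsmul, hF]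
  congr 1
  · simp
  · refine Finset.sum_congr rfl fun j _ => ?_
    rw [map_zsmul, Fin.val_succ, Fin.partialProd_contractNth]
    rcases Nat.even_or_odd ((j : ℕ) + 1) with h | h
    · simp only [h.neg_one_pow, one_smul]
      rfl
    · simp only [h.neg_one_pow, neg_smul, one_smul]
      rfl

theorem toInhomogeneous_injective (n : ℕ) : Function.Injective (toInhomogeneous M n) := by
  intro f₁ f₂ h
  refine Representation.IntertwiningMap.ext (linearMap_ext_wedge fun g => ?_)
  have H : f₁.toLinearMap ∘ₗ toExterior k G (n + 1) = f₂.toLinearMap ∘ₗ toExterior k G (n + 1) :=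
    equivariant_ext
      (fun h x => by simp [toExterior_chainRep, f₁.isIntertwining])
      (fun h x => by simp [toExterior_chainRep, f₂.isIntertwining])
      fun g => by simpa [toInhomogeneous] using congrFun h g
  simpa using LinearMap.congr_fun H (Finsupp.single g 1)

/-- An equivariant homogeneous cochain that vanishes on the kernel of `toExterior` is an exterior
cochain. -/
theorem exists_cochain_of_ker {n : ℕ} (F : Chain k G (n + 1) →ₗ[k] M)
    (hF : ∀ h x, F (chainRep h x) = M.ρ h (F x))
    (hF₀ : ∀ x, toExterior k G (n + 1) x = 0 → F x = 0) :
    ∃ f : Cochain M n, ∀ x, f (toExterior k G (n + 1) x) = F x := by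
  have hsurj := toExterior_surjective (k := k) (G := G) (n + 1)
  let f := (LinearMap.ker (toExterior k G (n + 1))).liftQ F hF₀ ∘ₗ
    ((toExterior k G (n + 1)).quotKerEquivOfSurjective hsurj).symm.toLinearMap
  have hf x : f (toExterior k G (n + 1) x) = F x := by
    have : ((toExterior k G (n + 1)).quotKerEquivOfSurjective hsurj).symm
        (toExterior k G (n + 1) x) = Submodule.Quotient.mk x := by
      rw [LinearEquiv.symm_apply_eq]
      rfl
    rw [LinearMap.comp_apply, LinearEquiv.coe_coe, this]
    exact Submodule.liftQ_apply _ F x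
  refine ⟨f.intertwiningMap_of_isIntertwiningMap _ _ fun h y => ?_, hf⟩
  obtain ⟨x, rfl⟩ := hsurj y
  rw [← toExterior_chainRep, hf, hf, hF]

/-- An inhomogeneous cochain whose coboundary is exterior becomes exterior after subtracting the
inhomogeneous form of `E ∘ ∂`, for some equivariant `E`. -/
theorem exists_toInhomogeneous_eq_sub [Finite G] (n : ℕ)
    (hs : ∀ m, 0 < m → m ≤ n → HasEquivariantSection k G m) (φ : (Fin n → G) → M)
    (f' : Cochain M (n + 1))
    (hφ : (inhomogeneousCochains.d M n).hom φ = toInhomogeneous M (n + 1) f') :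
    ∃ f : Cochain M n, ∃ E : Chain k G n →ₗ[k] M, (∀ h x, E (chainRep h x) = M.ρ h (E x)) ∧
      ∀ g, toInhomogeneous M n f g =
        φ g - E (chainBoundary k G n (Finsupp.single (Fin.partialProd g) 1)) := by
  obtain ⟨F, hF, hFφ⟩ := exists_equivariant_of_inhomogeneous M φ
  have hFf' : F ∘ₗ chainBoundary k G (n + 1) = f'.toLinearMap ∘ₗ toExterior k G (n + 2) := by
    refine equivariant_ext (fun h x => by simp [chainBoundary_chainRep, hF])
      (fun h x => by simp [toExterior_chainRep, f'.isIntertwining]) fun g => ?_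
    rw [LinearMap.comp_apply, inhomogeneous_comp_chainBoundary F hF]
    simpa [hFφ, toInhomogeneous] using congrFun hφ g
  obtain ⟨E, hE, hE₀⟩ := exists_eq_comp_chainBoundary_on_ker M.ρ n hs F hF fun x hx => by
    rw [← LinearMap.comp_apply, hFf', LinearMap.comp_apply, hx, map_zero]
  obtain ⟨f, hf⟩ := exists_cochain_of_ker (F - E ∘ₗ chainBoundary k G n)
    (fun h x => by simp [hF, hE, chainBoundary_chainRep])
    (fun x hx => by simp [hE₀ x hx])
  refine ⟨f, E, hE, fun g => ?_⟩
  have := hf (Finsupp.single (Fin.partialProd g) 1)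
  rw [toExterior_single] at this
  simp [toInhomogeneous, this, hFφ]

/-- The quotient of the inhomogeneous cochains by the exterior cochains is exact in degree `n + 1`
if all `Λᵐ k[G]` with `0 < m ≤ n + 1` admit equivariant sections. -/
theorem exists_toInhomogeneous_add_d [Finite G] (n : ℕ)
    (hs : ∀ m, 0 < m → m ≤ n + 1 → HasEquivariantSection k G m) (φ : (Fin (n + 1) → G) → M)
    (f' : Cochain M (n + 2))
    (hφ : (inhomogeneousCochains.d M (n + 1)).hom φ = toInhomogeneous M (n + 2) f') :
    ∃ (f : Cochain M (n + 1)) (ψ : (Fin n → G) → M),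
      φ = toInhomogeneous M (n + 1) f + (inhomogeneousCochains.d M n).hom ψ := by
  obtain ⟨f, E, hE, hf⟩ := exists_toInhomogeneous_eq_sub (n + 1) hs φ f' hφ
  refine ⟨f, fun g => E (Finsupp.single (Fin.partialProd g) 1), ?_⟩
  ext g
  rw [Pi.add_apply, hf, inhomogeneous_comp_chainBoundary E hE, sub_add_cancel]

/-- Every inhomogeneous `0`-cochain is exterior. -/
theorem toInhomogeneous_zero_surjective [Finite G] :
    Function.Surjective (toInhomogeneous M 0) := by
  intro φ
  obtain ⟨F, hF, hFφ⟩ := exists_equivariant_of_inhomogeneous M φ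
  obtain ⟨f, hf⟩ := exists_cochain_of_ker F hF fun x hx => by
    rw [toExterior_injective_of_subsingleton 1 (hx.trans (map_zero _).symm), map_zero]
  refine ⟨f, funext fun g => ?_⟩
  rw [← hFφ, ← hf, toExterior_single]
  rfl

/-- More than `|G|` elements of `G` have zero wedge product. -/
theorem subsingleton_cochain [Finite G] {n : ℕ} (hn : Nat.card G ≤ n) :
    Subsingleton (Cochain M n) := by
  refine ⟨fun f₁ f₂ => Representation.IntertwiningMap.ext (linearMap_ext_wedge fun g => ?_)⟩
  rw [wedge_eq_zero, map_zero, map_zero]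
  intro hg
  have := Nat.card_le_card_of_injective g hg
  simp at this
  omega

end Cochains

/-! ### Homology of complexes of modules -/

section Homology

variable {k : Type*} [Ring k] {ι : Type*} {c : ComplexShape ι}

/-- A map whose image lies in the image of `g` lifts through `g` after composing with an
epimorphism, namely the projection from the fibre product. -/
theorem exists_epi_comp_eq_comp {A X Y : ModuleCat.{u} k} (f : A ⟶ Y) (g : X ⟶ Y)
    (h : ∀ a, ∃ x, f a = g x) :
    ∃ (A' : ModuleCat.{u} k) (π : A' ⟶ A) (_ : Epi π) (x : A' ⟶ X), π ≫ f = x ≫ g := by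
  let P : Submodule k (A × X) := LinearMap.eqLocus (f.hom ∘ₗ LinearMap.fst k A X)
    (g.hom ∘ₗ LinearMap.snd k A X)
  refine ⟨ModuleCat.of k P, ModuleCat.ofHom (LinearMap.fst k A X ∘ₗ P.subtype), ?_,
    ModuleCat.ofHom (LinearMap.snd k A X ∘ₗ P.subtype), ?_⟩
  · rw [ModuleCat.epi_iff_surjective]
    intro a
    obtain ⟨x, hx⟩ := h a
    exact ⟨⟨(a, x), hx⟩, rfl⟩
  · ext p
    exact p.2

/-- A chain map of complexes of modules induces an isomorphism on homology if it does so by the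
usual chase of elements. -/
theorem isIso_homologyMap_of_elements {K L : HomologicalComplex (ModuleCat.{u} k) c} (φ : K ⟶ L)
    (i j l : ι) (hi : c.prev j = i) (hl : c.next j = l)
    (hmono : ∀ (x : K.X j) (y : L.X i), φ.f j x = L.d i j y → ∃ x', x = K.d i j x')
    (hepi : ∀ y : L.X j, L.d j l y = 0 → ∃ (x : K.X j) (y' : L.X i),
      K.d j l x = 0 ∧ y = φ.f j x + L.d i j y') :
    IsIso (HomologicalComplex.homologyMap φ j) := by
  have : Mono (HomologicalComplex.homologyMap φ j) := by
    rw [HomologicalComplex.mono_homologyMap_iff_up_to_refinements φ i j l hi hl]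
    intro A x hx y hy
    exact exists_epi_comp_eq_comp x (K.d i j) fun a =>
      hmono (x a) (y a) (LinearMap.congr_fun (congrArg ModuleCat.Hom.hom hy) a)
  have : Epi (HomologicalComplex.homologyMap φ j) := by
    rw [HomologicalComplex.epi_homologyMap_iff_up_to_refinements φ i j l hi hl]
    intro A y hy
    let Z := LinearMap.ker (K.d j l).hom
    let p : ModuleCat.of k (Z × L.X i) ⟶ K.X j :=
      ModuleCat.ofHom (Z.subtype ∘ₗ LinearMap.fst k Z (L.X i))
    let q : ModuleCat.of k (Z × L.X i) ⟶ L.X i := ModuleCat.ofHom (LinearMap.snd k Z (L.X i))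
    have hp : p ≫ K.d j l = 0 := by
      refine ModuleCat.hom_ext (LinearMap.ext fun z => ?_)
      exact z.1.2
    obtain ⟨A', π, hπ, x, hx⟩ := exists_epi_comp_eq_comp y (p ≫ φ.f j + q ≫ L.d i j) fun a => by
      obtain ⟨x, y', hx, hy'⟩ := hepi (y a) (LinearMap.congr_fun (congrArg ModuleCat.Hom.hom hy) a)
      exact ⟨(⟨x, hx⟩, y'), hy'⟩
    refine ⟨A', π, hπ, x ≫ p, by rw [Category.assoc, hp, Limits.comp_zero], x ≫ q, ?_⟩
    rw [hx, Preadditive.comp_add, Category.assoc, Category.assoc]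
  exact isIso_of_mono_of_epi _

end Homology

/-! ### The comparison map -/

section Comparison

variable {k G : Type u} [CommRing k] [Group G] [Finite G] (M : Rep.{u} k G)

theorem isIso_comparison (n : ℕ) (hs : ∀ m, 0 < m → m ≤ n → HasEquivariantSection k G m) :
    IsIso (comparison M n) := by
  have hd (n : ℕ) (x : (cochainComplex M).X n) (h : inhomogeneousCochains.d M n
      (toInhomogeneous M n x) = 0) : (cochainComplex M).d n (n + 1) x = 0 := by
    rw [cochainComplex_d]
    exact toInhomogeneous_injective (n + 1) <|
      ((toInhomogeneous_coboundary M n x).trans h).trans (map_zero (toInhomogeneous M (n + 1))).symm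
  have hdd (n : ℕ) (φ : (Fin (n + 1) → G) → M) (ψ : (Fin n → G) → M) :
      inhomogeneousCochains.d M (n + 1) (φ + (inhomogeneousCochains.d M n).hom ψ) =
        inhomogeneousCochains.d M (n + 1) φ := by
    have h₀ : inhomogeneousCochains.d M (n + 1) (inhomogeneousCochains.d M n ψ) = 0 :=
      LinearMap.congr_fun (congrArg ModuleCat.Hom.hom
        (groupCohomology.inhomogeneousCochains.d_comp_d (A := M) (n := n))) ψ
    exact (map_add (inhomogeneousCochains.d M (n + 1)).hom _ _).trans
      ((congrArg _ h₀).trans (add_zero _))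
  cases n with
  | zero =>
    refine isIso_homologyMap_of_elements _ 0 0 1 (by simp) (by simp) (fun x y hxy => ⟨0, ?_⟩)
      fun y hy => ?_
    · rw [HomologicalComplex.shape _ _ _ (by simp)] at hxy
      rw [map_zero]
      exact toInhomogeneous_injective 0 (hxy.trans (map_zero (toInhomogeneous M 0)).symm)
    · obtain ⟨f, rfl⟩ := toInhomogeneous_zero_surjective y
      rw [groupCohomology.inhomogeneousCochains.d_def] at hy
      refine ⟨f, 0, hd 0 f hy, ?_⟩
      rw [map_zero, add_zero]
      rfl
  | succ n =>
    refine isIso_homologyMap_of_elements _ n (n + 1) (n + 2) (by simp) (by simp)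
      (fun x y hxy => ?_) fun y hy => ?_
    · rw [groupCohomology.inhomogeneousCochains.d_def] at hxy
      rw [cochainComplex_d]
      -- Modulo coboundaries, `y` may be taken to be exterior.
      obtain ⟨f, hf⟩ : ∃ f : Cochain M n, inhomogeneousCochains.d M n y =
          inhomogeneousCochains.d M n (toInhomogeneous M n f) := by
        cases n with
        | zero =>
          obtain ⟨f, rfl⟩ := toInhomogeneous_zero_surjective y
          exact ⟨f, rfl⟩
        | succ n =>
          obtain ⟨f, ψ, rfl⟩ := exists_toInhomogeneous_add_d n
            (fun m h₀ hm => hs m h₀ (hm.trans (Nat.le_succ _))) y x hxy.symm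
          refine ⟨f, ?_⟩
          exact hdd n _ ψ
      refine ⟨f, toInhomogeneous_injective (n + 1) ?_⟩
      exact hxy.trans (hf.trans (toInhomogeneous_coboundary M n f).symm)
    · rw [groupCohomology.inhomogeneousCochains.d_def] at hy
      obtain ⟨f, ψ, rfl⟩ := exists_toInhomogeneous_add_d n hs y 0
        (hy.trans (map_zero (toInhomogeneous M (n + 2))).symm)
      refine ⟨f, ψ, hd _ f ((hdd n _ ψ).symm.trans hy), ?_⟩
      rw [groupCohomology.inhomogeneousCochains.d_def]
      rfl

theorem isZero_exteriorCohomology {n : ℕ} (hn : Nat.card G ≤ n) :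
    Limits.IsZero (exteriorCohomology M n) := by
  have := subsingleton_cochain (M := M) hn
  exact ShortComplex.isZero_homology_of_isZero_X₂ _
    (ModuleCat.isZero_of_subsingleton (ModuleCat.of k (Cochain M n)))

end Comparison

end ExteriorCohomology
end

theorem mainTheorem6 (ℓ : ℕ) (hℓ : ℓ.Prime) (G : Type) [Group G] [IsCyclic G]
    (hG : Nat.card G = ℓ) (M : Rep.{0} ℤ G) :
    (∀ i : ℕ, i ≤ ℓ - 1 → IsIso (ExteriorCohomology.comparison M i)) ∧
      ∀ i : ℕ, ℓ ≤ i → Limits.IsZero (ExteriorCohomology.exteriorCohomology M i) := by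
  have : Finite G := Nat.finite_of_card_ne_zero (hG ▸ hℓ.ne_zero)
  refine ⟨fun i hi => ExteriorCohomology.isIso_comparison M i fun m h₀ hm => ?_,
    fun i hi => ExteriorCohomology.isZero_exteriorCohomology M (hG ▸ hi)⟩
  have hmℓ : m < ℓ := by have := hℓ.pos; omega
  refine ExteriorCohomology.hasEquivariantSection_of_coprime ℤ ?_
  rw [hG]
  exact Nat.coprime_of_lt_prime h₀.ne' hmℓ hℓ
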